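/- **Theorem 1.4.** Let $n\in\mathbb N$ and let $E$ be one of the following spaces of test functions $\mathbb R^n\to\mathbb C$: the space $\mathscr D_a$ ($a>0$) of infinitely differentiable functions vanishing at all $x$ with $|x|>a$, with the Fréchet topology of uniform convergence of all derivatives; the space $\mathscr D=\bigcup_{m\ge 1}\mathscr D_m$ of compactly supported infinitely differentiable functions, with the strict inductive limit topology of the $\mathscr D_m$; or the Schwartz space $\mathscr S$ of rapidly decreasing infinitely differentiable functions, with its usual Fréchet topology. Let $U$ be a neighbourhood of $0$ in $E$ and let $Y$ be a Hausdorff locally convex space over $\mathbb C$. Put $\gamma_0(t)=t$ for $t\in\mathbb C$, and let $\mathscr K_{\gamma_0,U}(E,Y)$ be the set of all maps $f:E\to Y$ with $f(0)=0$ such that for all $\xi\in E$, $\eta\in U$ and $t\in\mathbb C$ with $|t|\le 1$ there is an $s\in\mathbb C$ with $|s|\le|\gamma_0(t)|$ and $f(\xi+t\eta)=f(\xi)+s f(\eta)$. Let $f_\nu\in\mathscr K_{\gamma_0,U}(E,Y)$ be continuous for every $\nu\in\mathbb N$, and suppose that the limit $f(\xi)=\lim_\nu f_\nu(\xi)$ exists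 in $Y$ for every $\xi\in E$. Then $f$ is a continuous mapping belonging to $\mathscr K_{\gamma_0,U}(E,Y)$, and for every bounded set $B\subset E$, $f_\nu(\xi)\to f(\xi)$ uniformly for $\xi\in B$. -/

import Mathlib

open Filter Topology
open scoped Distributions SchwartzMap

/-- Real `n`-space `ℝⁿ` with the Euclidean norm. -/
abbrev RealSpace (n : ℕ) : Type := EuclideanSpace ℝ (Fin n)

/-- The space `𝒟_a` of smooth functions `ℝⁿ → ℂ` that vanish at every `x` with `|x| > a`, with the
Fréchet topology of uniform convergence of all derivatives. -/
abbrev TestD_a (n : ℕ) (a : ℝ) : Type :=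
  𝓓_{(⟨Metric.closedBall (0 : RealSpace n) a, isCompact_closedBall 0 a⟩ :
    TopologicalSpace.Compacts (RealSpace n))}(RealSpace n, ℂ)

/-- The space `𝒟` of compactly supported smooth functions `ℝⁿ → ℂ`, with its usual (LF) topology,
the locally convex inductive limit topology. -/
abbrev TestD (n : ℕ) : Type :=
  𝓓((⊤ : TopologicalSpace.Opens (RealSpace n)), ℂ)

/-- The space `𝒮` of rapidly decreasing smooth functions `ℝⁿ → ℂ` with its Fréchet topology. -/
abbrev TestS (n : ℕ) : Type := 𝓢(RealSpace n, ℂ)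

/-- The family `𝒦_{γ,U}(X, Y)` of demi-linear mappings: all `f : X → Y` with `f 0 = 0` such that
for all `x ∈ X`, `u ∈ U` and `|t| ≤ 1` there is a scalar `s` with `|s| ≤ |γ t|` and
`f (x + t u) = f x + s f u`. -/
def demiLinearK {X Y : Type*} [AddCommGroup X] [Module ℂ X] [AddCommGroup Y] [Module ℂ Y]
    (γ : ℂ → ℂ) (U : Set X) : Set (X → Y) :=
  {f | f 0 = 0 ∧ ∀ x : X, ∀ u ∈ U, ∀ t : ℂ, ‖t‖ ≤ 1 →
    ∃ s : ℂ, ‖s‖ ≤ ‖γ t‖ ∧ f (x + t • u) = f x + s • f u}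

/-- The function `γ₀(t) = t`. -/
def gammaZero : ℂ → ℂ := fun t => t

/-! ### Equicontinuity of demi-linear maps on barrelled spaces -/

section DemiLinear

/-! Two properties of `E` suffice: it is barrelled, and its bounded sets are totally bounded. For a
continuous seminorm `p` on `Y`, the closed convex hull of the points near `0` where `p (F ν ·) ≤ 1`
for all `ν` is a barrel. Demi-linearity replaces convexity: adding `w • z` changes the value by at
most `w * p (F ν z)`, so the bound `1` survives convex combinations (`seminorm_sum_smul_le`), giving
equicontinuity at `0` (`eventually_forall_seminorm_le`). Taking `t = 1` in the defining identity
makes it uniform over base points, so the limit is continuous and convergence is uniform on totally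
bounded sets (`demiLinearK_limit`). The Schwartz space and `𝒟_a` are complete and first countable,
hence Baire and barrelled; barrelledness passes to `𝒟` through the inductive limit. Total
boundedness is an Arzelà–Ascoli argument in the Schwartz space, inherited by `𝒟_a` as a subspace and
by `𝒟` because bounded sets there have a common compact support. -/

open scoped ComplexOrder in
/-- A complex topological vector space that is locally convex over `ℝ` is polynormable over `ℂ`. -/
theorem polynormableSpace_complex_of_locallyConvexSpace_real (Y : Type*) [AddCommGroup Y]
    [Module ℂ Y] [TopologicalSpace Y] [IsTopologicalAddGroup Y] [ContinuousSMul ℂ Y]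
    [LocallyConvexSpace ℝ Y] : PolynormableSpace ℂ Y := by
  have : LocallyConvexSpace ℂ Y := by
    refine (locallyConvexSpace_iff_exists_convex_subset_zero ℂ Y).2 fun U hU => ?_
    obtain ⟨S, hS, hc, hSU⟩ := (locallyConvexSpace_iff_exists_convex_subset_zero ℝ Y).1
      inferInstance U hU
    exact ⟨S, hS, convex_RCLike_iff_convex_real.2 hc, hSU⟩
  have : ContinuousSMul ℝ Y := IsScalarTower.continuousSMul ℂ
  infer_instance

open scoped Pointwise in
/-- In a barrelled space, barrels are neighbourhoods of zero. -/
theorem BarrelledSpace.mem_nhds_zero {E : Type*} [AddCommGroup E] [Module ℝ E]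
    [TopologicalSpace E] [IsTopologicalAddGroup E] [ContinuousSMul ℝ E] [BarrelledSpace ℝ E]
    {B : Set E} (hcl : IsClosed B) (hconv : Convex ℝ B) (hbal : Balanced ℝ B)
    (habs : Absorbent ℝ B) : B ∈ 𝓝 (0 : E) := by
  have h0 : (0 : E) ∈ B := habs.zero_mem
  let q : Seminorm ℝ E := gaugeSeminorm hbal hconv habs
  have hq : Continuous q := by
    refine q.continuous_of_lowerSemicontinuous
      (lowerSemicontinuous_iff_isClosed_preimage.2 fun y => ?_)
    rcases lt_or_ge y 0 with hy | hy
    · convert isClosed_empty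
      ext x
      simpa using hy.trans_le (apply_nonneg q x)
    · have : q ⁻¹' Set.Iic y = {x | gauge B x ≤ y} := rfl
      rw [this, setOfPred_gauge_le_eq hconv h0 habs hy]
      exact isClosed_iInter fun r => isClosed_iInter fun hr =>
        hcl.smul_of_ne_zero (hy.trans_lt hr).ne'
  have hlt : {x | q x < 1} ∈ 𝓝 (0 : E) :=
    (isOpen_lt hq continuous_const).mem_nhds (by simp)
  exact mem_of_superset hlt (setOfPred_gauge_lt_one_subset_self hconv h0 habs)

variable {E Y : Type*} [AddCommGroup E] [Module ℝ E] [AddCommGroup Y] [Module ℂ Y]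

/-- The summands are added one at a time; the base point in `hf` is arbitrary, so partial sums may
leave `U`. -/
theorem seminorm_sum_smul_le {f : E → Y} (hf0 : f 0 = 0) {U : Set E} {p : Seminorm ℂ Y}
    (hf : ∀ x, ∀ u ∈ U, ∀ t : ℝ, |t| ≤ 1 → p (f (x + t • u) - f x) ≤ |t| * p (f u))
    {ι : Type*} (s : Finset ι) {w : ι → ℝ} {z : ι → E} (hw0 : ∀ i ∈ s, 0 ≤ w i)
    (hw1 : ∀ i ∈ s, w i ≤ 1) (hz : ∀ i ∈ s, z i ∈ U) (hpz : ∀ i ∈ s, p (f (z i)) ≤ 1) :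
    p (f (∑ i ∈ s, w i • z i)) ≤ ∑ i ∈ s, w i := by
  classical
  induction s using Finset.induction_on with
  | empty => simp [hf0]
  | insert a s ha ih =>
    simp only [Finset.mem_insert, forall_eq_or_imp] at hw0 hw1 hz hpz
    rw [Finset.sum_insert ha, Finset.sum_insert ha, add_comm, add_comm (w a)]
    set x := ∑ i ∈ s, w i • z i
    have h1 := hf x (z a) hz.1 (w a) (by rw [abs_of_nonneg hw0.1]; exact hw1.1)
    rw [abs_of_nonneg hw0.1] at h1
    have h2 : p (f (x + w a • z a)) ≤ p (f (x + w a • z a) - f x) + p (f x) := by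
      simpa using map_add_le_add p (f (x + w a • z a) - f x) (f x)
    nlinarith [ih hw0.2 hw1.2 hz.2 hpz.2, hpz.1, hw0.1]

variable [TopologicalSpace E] [IsTopologicalAddGroup E] [ContinuousSMul ℝ E] [BarrelledSpace ℝ E]
  [TopologicalSpace Y]

open scoped Pointwise in
/-- Banach–Steinhaus for demi-linear maps: a pointwise bounded family of continuous maps on a
barrelled space is equicontinuous at zero. -/
theorem eventually_forall_seminorm_le {ι : Type*} {F : ι → E → Y} (hcont : ∀ i, Continuous (F i))
    (hF0 : ∀ i, F i 0 = 0) {U : Set E} (hU : U ∈ 𝓝 0) {p : Seminorm ℂ Y} (hp : Continuous p)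
    (hF : ∀ i x, ∀ u ∈ U, ∀ t : ℝ, |t| ≤ 1 → p (F i (x + t • u) - F i x) ≤ |t| * p (F i u))
    (hbdd : ∀ x, ∃ C, ∀ i, p (F i x) ≤ C) {ε : ℝ} (hε : 0 < ε) :
    ∀ᶠ v in 𝓝 (0 : E), ∀ i, p (F i v) ≤ ε := by
  have hsmul : ∀ i, ∀ u ∈ U, ∀ t : ℝ, |t| ≤ 1 → p (F i (t • u)) ≤ |t| * p (F i u) := by
    intro i u hu t ht
    simpa [hF0] using hF i 0 u hu t ht
  set V := balancedCore ℝ U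
  have hVU : V ⊆ U := balancedCore_subset U
  have hV : V ∈ 𝓝 (0 : E) := balancedCore_mem_nhds_zero hU
  -- `T` need not be convex, so its closed convex hull will serve as the barrel; the balanced core
  -- makes `T` balanced.
  let T : Set E := {u | u ∈ V ∧ ∀ i, p (F i u) ≤ 1}
  have hTbal : Balanced ℝ T := by
    rintro a ha _ ⟨u, ⟨huV, hu⟩, rfl⟩
    refine ⟨(balancedCore_balanced U).smul_mem ha huV, fun i => ?_⟩
    exact (hsmul i u (hVU huV) a ha).trans (mul_le_one₀ ha (apply_nonneg _ _) (hu i))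
  have hTabs : Absorbent ℝ T := by
    refine absorbent_iff_forall_absorbs_singleton.2 fun x => ?_
    obtain ⟨c, hc0, hc⟩ : ∃ c : ℝ, c ≠ 0 ∧ c • x ∈ V := by
      have h : Tendsto (fun c : ℝ => c • x) (𝓝[≠] 0) (𝓝 0) := by
        have : Tendsto (fun c : ℝ => c • x) (𝓝 0) (𝓝 ((0 : ℝ) • x)) :=
          (continuous_id.smul continuous_const).tendsto 0
        rw [zero_smul] at this
        exact this.mono_left nhdsWithin_le_nhds
      obtain ⟨c, hc, hc0⟩ := ((h.eventually hV).and self_mem_nhdsWithin).exists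
      exact ⟨c, hc0, hc⟩
    obtain ⟨C, hC⟩ := hbdd (c • x)
    set M := max C 1
    have hM : 1 ≤ M := le_max_right _ _
    have hM0 : 0 < M := one_pos.trans_le hM
    have hMi : |M⁻¹| ≤ 1 := by rw [abs_of_pos (inv_pos.2 hM0)]; exact inv_le_one_of_one_le₀ hM
    have hmem : M⁻¹ • c • x ∈ T := by
      refine ⟨(balancedCore_balanced U).smul_mem hMi hc, fun i => ?_⟩
      refine (hsmul i _ (hVU hc) _ hMi).trans ?_
      rw [abs_of_pos (inv_pos.2 hM0), inv_mul_le_one₀ hM0]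
      exact (hC i).trans (le_max_left _ _)
    have hd : M⁻¹ * c ≠ 0 := mul_ne_zero (inv_ne_zero hM0.ne') hc0
    refine absorbs_iff_norm.2 ⟨‖(M⁻¹ * c)⁻¹‖, fun a ha => Set.singleton_subset_iff.2 ?_⟩
    refine hTbal.smul_mono ha ⟨_, hmem, ?_⟩
    change (M⁻¹ * c)⁻¹ • M⁻¹ • c • x = x
    rw [smul_smul M⁻¹, inv_smul_smul₀ hd]
  let B : Set E := closure (convexHull ℝ T)
  have hTB : T ⊆ B := (subset_convexHull ℝ T).trans subset_closure
  have hB : B ∈ 𝓝 (0 : E) := BarrelledSpace.mem_nhds_zero isClosed_closure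
    (convex_convexHull ℝ T).closure hTbal.convexHull.closure (hTabs.mono hTB)
  have hBle : ∀ x ∈ B, ∀ i, p (F i x) ≤ 1 := by
    intro x hx i
    refine closure_minimal (s := convexHull ℝ T) (t := {x | p (F i x) ≤ 1}) ?_
      (isClosed_le (hp.comp (hcont i)) continuous_const) hx
    intro y hy
    obtain ⟨κ, _, w, z, hw0, hw1, hz, rfl⟩ := mem_convexHull_iff_exists_fintype.1 hy
    have := seminorm_sum_smul_le (hF0 i) (hF i) Finset.univ (w := w) (z := z)
      (fun k _ => hw0 k)
      (fun k _ => hw1 ▸ Finset.single_le_sum (fun j _ => hw0 j) (Finset.mem_univ k))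
      (fun k _ => hVU (hz k).1) (fun k _ => (hz k).2 i)
    exact this.trans hw1.le
  -- Scaling by `δ` turns the bound `1` on `B` into `ε`; the cap at `1` keeps `δ` an admissible
  -- parameter in `hsmul`.
  set δ := min ε 1
  have hδ : 0 < δ := lt_min hε one_pos
  have hlim : Tendsto (fun v : E => δ⁻¹ • v) (𝓝 0) (𝓝 0) := by
    simpa using (continuous_const_smul δ⁻¹ : Continuous fun v : E => δ⁻¹ • v).tendsto 0
  filter_upwards [hlim.eventually hB, hlim.eventually hU] with v hvB hvU i
  have h := hsmul i _ hvU δ (by rw [abs_of_pos hδ]; exact min_le_right _ _)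
  rw [smul_inv_smul₀ hδ.ne', abs_of_pos hδ] at h
  calc p (F i v) ≤ δ * p (F i (δ⁻¹ • v)) := h
    _ ≤ δ * 1 := by gcongr; exact hBle _ hvB i
    _ ≤ ε := by rw [mul_one]; exact min_le_left _ _

end DemiLinear

/-- The scalars `s ν` lie in a compact disc, so a subsequence converges, and its limit serves for
`f`. -/
theorem mem_demiLinearK_of_tendsto {X Y : Type*} [AddCommGroup X] [Module ℂ X] [AddCommGroup Y]
    [Module ℂ Y] [TopologicalSpace Y] [IsTopologicalAddGroup Y] [ContinuousSMul ℂ Y] [T2Space Y]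
    {γ : ℂ → ℂ} {U : Set X} {F : ℕ → X → Y} {f : X → Y} (hF : ∀ ν, F ν ∈ demiLinearK γ U)
    (hlim : ∀ ξ, Tendsto (fun ν => F ν ξ) atTop (𝓝 (f ξ))) : f ∈ demiLinearK γ U := by
  refine ⟨tendsto_nhds_unique (hlim 0) (by simp [(hF _).1]), fun x u hu t ht => ?_⟩
  choose s hs hsF using fun ν => (hF ν).2 x u hu t ht
  obtain ⟨a, ha, φ, hφ, hφa⟩ := (isCompact_closedBall (0 : ℂ) ‖γ t‖).tendsto_subseq
    (x := s) (fun ν => by simpa using hs ν)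
  refine ⟨a, by simpa using ha, ?_⟩
  refine tendsto_nhds_unique ((hlim (x + t • u)).comp hφ.tendsto_atTop) ?_
  have := ((hlim x).comp hφ.tendsto_atTop).add (hφa.smul ((hlim u).comp hφ.tendsto_atTop))
  exact this.congr fun ν => (hsF (φ ν)).symm

theorem seminorm_sub_le_of_mem_demiLinearK {X Y : Type*} [AddCommGroup X] [Module ℂ X]
    [Module ℝ X] [IsScalarTower ℝ ℂ X] [AddCommGroup Y] [Module ℂ Y] {U : Set X} {f : X → Y}
    (hf : f ∈ demiLinearK gammaZero U) (p : Seminorm ℂ Y) (x : X) {u : X} (hu : u ∈ U) {t : ℝ}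
    (ht : |t| ≤ 1) : p (f (x + t • u) - f x) ≤ |t| * p (f u) := by
  obtain ⟨s, hs, h⟩ := hf.2 x u hu (t : ℂ) (by simpa using ht)
  have hsm : (t : ℂ) • u = t • u := by
    rw [← algebraMap_smul ℂ t u]; rfl
  rw [hsm] at h
  rw [h, add_sub_cancel_left, map_smul_eq_mul]
  gcongr
  simpa [gammaZero] using hs

/-- Banach–Steinhaus theorem for sequences of demi-linear maps on a barrelled space whose bounded
sets are totally bounded. -/
theorem demiLinearK_limit {E Y : Type*} [AddCommGroup E] [Module ℂ E] [Module ℝ E]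
    [IsScalarTower ℝ ℂ E] [UniformSpace E] [IsUniformAddGroup E] [ContinuousSMul ℝ E]
    [BarrelledSpace ℝ E]
    (htb : ∀ B : Set E, Bornology.IsVonNBounded ℝ B → TotallyBounded B)
    [AddCommGroup Y] [Module ℂ Y] [UniformSpace Y] [IsUniformAddGroup Y] [ContinuousSMul ℂ Y]
    [LocallyConvexSpace ℝ Y] [T2Space Y] {U : Set E} (hU : U ∈ 𝓝 0) {F : ℕ → E → Y} {f : E → Y}
    (hF : ∀ ν, Continuous (F ν) ∧ F ν ∈ demiLinearK gammaZero U)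
    (hlim : ∀ ξ, Tendsto (fun ν => F ν ξ) atTop (𝓝 (f ξ))) :
    (Continuous f ∧ f ∈ demiLinearK gammaZero U) ∧
      ∀ B : Set E, Bornology.IsVonNBounded ℂ B → TendstoUniformlyOn F f atTop B := by
  have := polynormableSpace_complex_of_locallyConvexSpace_real Y
  have hY := PolynormableSpace.withSeminorms ℂ Y
  have hfK := mem_demiLinearK_of_tendsto (fun ν => (hF ν).2) hlim
  -- With `t = 1`, an increment by `v ∈ U` is at most `p (F ν v)` at every base point, so smallness
  -- near `0` is uniform in `x` and `ν` and passes to the limit.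
  have hequi : ∀ p : Seminorm ℂ Y, Continuous p → ∀ ε > 0, ∀ᶠ v in 𝓝 (0 : E),
      (∀ ν x, p (F ν (x + v) - F ν x) ≤ ε) ∧ ∀ x, p (f (x + v) - f x) ≤ ε := by
    intro p hp ε hε
    have h := eventually_forall_seminorm_le (fun ν => (hF ν).1) (fun ν => (hF ν).2.1) hU hp
      (fun ν x u hu t ht => seminorm_sub_le_of_mem_demiLinearK (hF ν).2 p x hu ht)
      (fun x => by
        obtain ⟨C, hC⟩ := ((hp.tendsto _).comp (hlim x)).bddAbove_range
        exact ⟨C, fun i => hC ⟨i, rfl⟩⟩) hε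
    filter_upwards [h, hU] with v hv hvU
    have h1 : ∀ ν x, p (F ν (x + v) - F ν x) ≤ ε := fun ν x => by
      have := seminorm_sub_le_of_mem_demiLinearK (hF ν).2 p x hvU (t := 1) (by simp)
      rw [one_smul, abs_one, one_mul] at this
      exact this.trans (hv ν)
    exact ⟨h1, fun x => le_of_tendsto ((hp.tendsto _).comp ((hlim (x + v)).sub (hlim x)))
      (Eventually.of_forall fun ν => h1 ν x)⟩
  refine ⟨⟨continuous_iff_continuousAt.2 fun x => ?_, hfK⟩, fun B hB => ?_⟩
  · refine (hY.tendsto_nhds f (f x)).2 fun p ε hε => ?_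
    have hx : Tendsto (fun y => y - x) (𝓝 x) (𝓝 0) := by
      simpa using (continuous_sub_right x).tendsto x
    filter_upwards [hx.eventually (hequi _ p.2 (ε / 2) (half_pos hε))] with y hy
    have := hy.2 x
    rw [add_sub_cancel] at this
    exact this.trans_lt (half_lt_self hε)
  · rw [tendstoUniformlyOn_iff_tendsto, uniformity_eq_comap_nhds_zero, tendsto_comap_iff,
      hY.tendsto_nhds]
    intro p ε hε
    -- Finitely many translates of the equicontinuity neighbourhood cover `B`, so pointwise
    -- convergence at their centres is enough.
    obtain ⟨t, ht, hBt⟩ := totallyBounded_iff_subset_finite_iUnion_nhds_zero.1 (htb B (hB.restrict_scalars ℝ)) _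
      (hequi _ p.2 (ε / 4) (by positivity))
    have hev : ∀ᶠ ν in atTop, ∀ y ∈ t, p.1 (F ν y - f y) < ε / 4 :=
      ht.eventually_all.2 fun y _ => (hY.tendsto_nhds _ _).1 (hlim y) p _ (by positivity)
    rw [eventually_prod_principal_iff]
    filter_upwards [hev] with ν hν x hx
    obtain ⟨y, hy, v, hv, rfl⟩ := Set.mem_iUnion₂.1 (hBt hx)
    have h1 := hv.1 ν y
    have h2 := hv.2 y
    have h3 := hν y hy
    have e : F ν (y + v) - f (y + v) =
        (F ν (y + v) - F ν y) + (F ν y - f y) - (f (y + v) - f y) := by abel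
    change p.1 (F ν (y + v) - f (y + v) - 0) < ε
    rw [sub_zero, e]
    have h4 := map_sub_le_add p.1 ((F ν (y + v) - F ν y) + (F ν y - f y)) (f (y + v) - f y)
    have h5 := map_add_le_add p.1 (F ν (y + v) - F ν y) (F ν y - f y)
    linarith

/-! ### Cauchy filters and total boundedness through seminorms -/

theorem WithSeminorms.cauchy_iff {𝕜 E ι : Type*} [NormedField 𝕜] [AddCommGroup E] [Module 𝕜 E]
    [Nonempty ι] [UniformSpace E] [IsUniformAddGroup E] {p : SeminormFamily 𝕜 E ι}
    (hp : WithSeminorms p) {l : Filter E} [l.NeBot] :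
    Cauchy l ↔ ∀ i, ∀ ε > 0, ∃ A ∈ l, ∀ x ∈ A, ∀ y ∈ A, p i (x - y) < ε := by
  rw [p.withSeminorms_iff_uniformSpace_eq_iInf] at hp
  rw [hp, cauchy_iInf_uniformSpace']
  refine forall_congr' fun i => ?_
  let _ : SeminormedAddCommGroup E := (p i).toSeminormedAddCommGroup
  have h := Metric.cauchy_iff (f := l)
  simp only [dist_eq_norm] at h
  exact h.trans (and_iff_right ‹_›)

/-- An ultrafilter containing `B` contains a piece of each finite cover, hence is Cauchy for each
seminorm. -/
theorem WithSeminorms.totallyBounded {𝕜 E ι : Type*} [NormedField 𝕜] [AddCommGroup E]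
    [Module 𝕜 E] [Nonempty ι] [UniformSpace E] [IsUniformAddGroup E] {p : SeminormFamily 𝕜 E ι}
    (hp : WithSeminorms p) {B : Set E}
    (h : ∀ i, ∀ ε > 0, ∃ 𝒜 : Set (Set E), 𝒜.Finite ∧ B ⊆ ⋃₀ 𝒜 ∧
      ∀ A ∈ 𝒜, ∀ x ∈ A, ∀ y ∈ A, p i (x - y) < ε) : TotallyBounded B := by
  refine totallyBounded_iff_ultrafilter.2 fun l hl => hp.cauchy_iff.2 fun i ε hε => ?_
  obtain ⟨𝒜, hfin, hB, hA⟩ := h i ε hε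
  obtain ⟨A, hA𝒜, hAl⟩ := (Ultrafilter.finite_sUnion_mem_iff hfin).1
    (mem_of_superset (le_principal_iff.1 hl) hB)
  exact ⟨A, hAl, hA A hA𝒜⟩

/-! ### Schwartz space: completeness and total boundedness of bounded sets -/

namespace SchwartzMap

variable {E F : Type*} [NormedAddCommGroup E] [NormedSpace ℝ E] [NormedAddCommGroup F]
  [NormedSpace ℝ F]

theorem iteratedFDeriv_sub_apply (f g : 𝓢(E, F)) (n : ℕ) (x : E) :
    iteratedFDeriv ℝ n (f - g : 𝓢(E, F)) x = iteratedFDeriv ℝ n f x - iteratedFDeriv ℝ n g x := by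
  have : ((f - g : 𝓢(E, F)) : E → F) = (f : E → F) - g := by ext; simp
  rw [this, _root_.iteratedFDeriv_sub_apply ((f.smooth n).contDiffAt) ((g.smooth n).contDiffAt)]

theorem norm_pow_mul_iteratedFDeriv_sub_le (f g : 𝓢(E, F)) (k n : ℕ) (x : E) :
    ‖x‖ ^ k * ‖iteratedFDeriv ℝ n f x - iteratedFDeriv ℝ n g x‖ ≤
      SchwartzMap.seminorm ℝ k n (f - g) := by
  rw [← iteratedFDeriv_sub_apply]
  exact le_seminorm ℝ k n (f - g) x

theorem hasFTaylorSeriesUpTo_of_tendstoUniformly {u : ℕ → 𝓢(E, F)}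
    {G : E → FormalMultilinearSeries ℝ E F}
    (hG : ∀ n, TendstoUniformly (fun a x => iteratedFDeriv ℝ n (u a) x) (fun x => G x n) atTop) :
    HasFTaylorSeriesUpTo (⊤ : ℕ∞) (fun x => (G x 0).curry0) G := by
  have hd : ∀ (n : ℕ) (x : E), HasFDerivAt (fun x => G x n) (G x n.succ).curryLeft x := by
    intro n
    have hu := (continuousMultilinearCurryLeftEquiv ℝ (fun _ : Fin (n + 1) => E)
      F).isometry.uniformContinuous.comp_tendstoUniformly (hG (n + 1))
    refine hasFDerivAt_of_tendstoUniformly hu (fun a x => ?_) fun x => (hG n).tendsto_at x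
    exact (contDiff_iff_ftaylorSeries.1 ((u a).smooth ⊤)).fderiv n (by exact_mod_cast WithTop.coe_lt_top n) x
  exact (hasFTaylorSeriesUpTo_top_iff' le_rfl).2 ⟨fun _ => rfl, hd⟩

/-- All derivatives converge pointwise; letting one index tend to infinity in the Cauchy bounds
makes this uniform with every weight, so the limits are the derivatives of one Schwartz function. -/
theorem exists_tendsto_of_cauchySeq [CompleteSpace F] {u : ℕ → 𝓢(E, F)} (hu : CauchySeq u) :
    ∃ f, Tendsto u atTop (𝓝 f) := by
  have hC : ∀ k n : ℕ, ∀ ε > 0, ∃ N, ∀ a ≥ N, ∀ b ≥ N,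
      SchwartzMap.seminorm ℝ k n (u a - u b) < ε := by
    intro k n ε hε
    obtain ⟨A, hA, h⟩ := (schwartz_withSeminorms ℝ E F).cauchy_iff.1 hu (k, n) ε hε
    obtain ⟨N, hN⟩ := mem_atTop_sets.1 (mem_map.1 hA)
    exact ⟨N, fun a ha b hb => h _ (hN a ha) _ (hN b hb)⟩
  have hlim : ∀ (x : E) (n : ℕ), ∃ L, Tendsto (fun a => iteratedFDeriv ℝ n (u a) x) atTop (𝓝 L) := by
    intro x n
    refine cauchySeq_tendsto_of_complete (Metric.cauchySeq_iff.2 fun ε hε => ?_)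
    obtain ⟨N, hN⟩ := hC 0 n ε hε
    refine ⟨N, fun a ha b hb => ?_⟩
    have := norm_pow_mul_iteratedFDeriv_sub_le (u a) (u b) 0 n x
    rw [pow_zero, one_mul] at this
    rw [dist_eq_norm]
    exact this.trans_lt (hN a ha b hb)
  choose G hG using hlim
  have hunif : ∀ k n : ℕ, ∀ ε > 0, ∃ N, ∀ a ≥ N, ∀ x,
      ‖x‖ ^ k * ‖iteratedFDeriv ℝ n (u a) x - G x n‖ ≤ ε := by
    intro k n ε hε
    obtain ⟨N, hN⟩ := hC k n ε hε
    refine ⟨N, fun a ha x => ?_⟩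
    refine le_of_tendsto ((tendsto_const_nhds.sub (hG x n)).norm.const_mul (‖x‖ ^ k))
      ((eventually_ge_atTop N).mono fun b hb => ?_)
    exact (norm_pow_mul_iteratedFDeriv_sub_le (u a) (u b) k n x).trans (hN a ha b hb).le
  have hT : HasFTaylorSeriesUpTo (⊤ : ℕ∞) (fun x => (G x 0).curry0) G := by
    refine hasFTaylorSeriesUpTo_of_tendstoUniformly (u := u) fun n => ?_
    refine Metric.tendstoUniformly_iff.2 fun ε hε => ?_
    obtain ⟨N, hN⟩ := hunif 0 n (ε / 2) (half_pos hε)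
    filter_upwards [eventually_ge_atTop N] with a ha x
    have := hN a ha x
    rw [pow_zero, one_mul] at this
    rw [dist_comm, dist_eq_norm]
    exact this.trans_lt (half_lt_self hε)
  have hiter : ∀ n x, iteratedFDeriv ℝ n (fun x => (G x 0).curry0) x = G x n := fun n x =>
    (hT.eq_iteratedFDeriv (by exact_mod_cast le_top) x).symm
  let f : 𝓢(E, F) :=
    { toFun := fun x => (G x 0).curry0
      smooth' := hT.contDiff
      decay' := fun k n => by
        obtain ⟨N, hN⟩ := hunif k n 1 one_pos
        refine ⟨SchwartzMap.seminorm ℝ k n (u N) + 1, fun x => ?_⟩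
        rw [hiter]
        calc ‖x‖ ^ k * ‖G x n‖
            ≤ ‖x‖ ^ k * (‖iteratedFDeriv ℝ n (u N) x‖ +
              ‖iteratedFDeriv ℝ n (u N) x - G x n‖) := by
              gcongr
              have := norm_sub_le (iteratedFDeriv ℝ n (u N) x) (iteratedFDeriv ℝ n (u N) x - G x n)
              rwa [sub_sub_cancel] at this
          _ ≤ _ := by
              rw [mul_add]
              exact add_le_add (le_seminorm ℝ k n (u N) x) (hN N le_rfl x) }
  refine ⟨f, ((schwartz_withSeminorms ℝ E F).tendsto_nhds u f).2 fun ⟨k, n⟩ ε hε => ?_⟩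
  obtain ⟨N, hN⟩ := hunif k n (ε / 2) (half_pos hε)
  filter_upwards [eventually_ge_atTop N] with a ha
  refine lt_of_le_of_lt ?_ (half_lt_self hε)
  refine seminorm_le_bound ℝ k n _ (half_pos hε).le fun x => ?_
  rw [iteratedFDeriv_sub_apply]
  change ‖x‖ ^ k * ‖_ - iteratedFDeriv ℝ n (fun x => (G x 0).curry0) x‖ ≤ _
  rw [hiter]
  exact hN a ha x

instance instCompleteSpace [CompleteSpace F] : CompleteSpace 𝓢(E, F) :=
  have := IsUniformAddGroup.uniformity_countably_generated (α := 𝓢(E, F))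
  UniformSpace.complete_of_cauchySeq_tendsto fun _ => exists_tendsto_of_cauchySeq

instance instBaireSpace [CompleteSpace F] : BaireSpace 𝓢(E, F) := by
  have := IsUniformAddGroup.uniformity_countably_generated (α := 𝓢(E, F))
  infer_instance

theorem norm_iteratedFDeriv_sub_le (f : 𝓢(E, F)) (n : ℕ) (x y : E) :
    ‖iteratedFDeriv ℝ n f x - iteratedFDeriv ℝ n f y‖ ≤
      SchwartzMap.seminorm ℝ 0 (n + 1) f * ‖x - y‖ := by
  have hd : Differentiable ℝ (iteratedFDeriv ℝ n f) :=
    (f.smooth (n + 1 : ℕ)).differentiable_iteratedFDeriv (by exact_mod_cast n.lt_succ_self)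
  refine convex_univ.norm_image_sub_le_of_norm_fderiv_le (fun z _ => hd z) (fun z _ => ?_)
    (Set.mem_univ y) (Set.mem_univ x)
  rw [norm_fderiv_iteratedFDeriv]
  exact norm_iteratedFDeriv_le_seminorm ℝ f (n + 1) z

/-- Bounded subsets of the Schwartz space are totally bounded. -/
theorem totallyBounded_of_seminorm_le [FiniteDimensional ℝ E] [FiniteDimensional ℝ F]
    {B : Set 𝓢(E, F)} (hB : ∀ k n, ∃ C, ∀ f ∈ B, SchwartzMap.seminorm ℝ k n f ≤ C) :
    TotallyBounded B := by
  have : ProperSpace E := FiniteDimensional.proper_real E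
  refine (schwartz_withSeminorms ℝ E F).totallyBounded fun ⟨k, n⟩ ε hε => ?_
  have : FiniteDimensional ℝ (E [×n]→L[ℝ] F) :=
    FiniteDimensional.of_injective (ContinuousMultilinearMap.toMultilinearMapLinear :
      (E [×n]→L[ℝ] F) →ₗ[ℝ] MultilinearMap ℝ (fun _ : Fin n => E) F)
      ContinuousMultilinearMap.toMultilinearMap_injective
  have : ProperSpace (E [×n]→L[ℝ] F) := FiniteDimensional.proper_real _
  obtain ⟨C₀, hC₀⟩ := hB 0 n
  obtain ⟨C₁, hC₁⟩ := hB (k + 1) n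
  obtain ⟨C₂, hC₂⟩ := hB 0 (n + 1)
  -- Outside radius `R` one extra power of `‖x‖` suffices: the weighted difference is at most `2 *
  -- C₁ / R ≤ ε / 2`. Inside, the weight is at most `R ^ k`, which dictates `η`.
  set R : ℝ := max 1 (4 * C₁ / ε)
  have hR : 1 ≤ R := le_max_left _ _
  have hR0 : 0 < R := one_pos.trans_le hR
  have hRC : 4 * C₁ ≤ ε * R := by
    rw [← div_le_iff₀' hε]
    exact le_max_right _ _
  set η : ℝ := ε / (2 * R ^ k)
  have hη : 0 < η := by positivity
  have hRη : R ^ k * η = ε / 2 := by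
    simp only [η]
    field_simp
  -- `C₂` is a common Lipschitz constant of the `n`-th derivatives, so moving by `δ` costs at most
  -- `η / 8`.
  set δ : ℝ := η / (8 * (|C₂| + 1))
  have hδ : 0 < δ := by positivity
  have hCδ : C₂ * δ ≤ η / 8 := by
    have h1 : (|C₂| + 1) * δ = η / 8 := by
      simp only [δ]
      field_simp
    nlinarith [le_abs_self C₂]
  obtain ⟨t, -, htfin, ht⟩ := (isCompact_closedBall (0 : E) R).finite_cover_balls hδ
  have := htfin.fintype
  -- Sampling on the finite net lands in a finite-dimensional space, where bounded sets are totally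
  -- bounded; the pieces of `B` are preimages of small balls there.
  let ev : 𝓢(E, F) → t → E [×n]→L[ℝ] F := fun f y => iteratedFDeriv ℝ n f y
  have hev : TotallyBounded (ev '' B) := by
    refine (isCompact_closedBall (0 : t → E [×n]→L[ℝ] F) |C₀|).totallyBounded.subset ?_
    rintro _ ⟨f, hf, rfl⟩
    rw [mem_closedBall_zero_iff, pi_norm_le_iff_of_nonneg (abs_nonneg _)]
    exact fun y => (norm_iteratedFDeriv_le_seminorm ℝ f n y).trans
      ((hC₀ f hf).trans (le_abs_self _))
  obtain ⟨c, hc, hcB⟩ := Metric.totallyBounded_iff.1 hev (η / 8) (by positivity)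
  refine ⟨(fun z => B ∩ ev ⁻¹' Metric.ball z (η / 8)) '' c, hc.image _, fun f hf => ?_, ?_⟩
  · obtain ⟨z, hz, hfz⟩ := Set.mem_iUnion₂.1 (hcB ⟨f, hf, rfl⟩)
    exact ⟨_, ⟨z, hz, rfl⟩, hf, hfz⟩
  rintro _ ⟨z, -, rfl⟩ f ⟨hf, hfz⟩ g ⟨hg, hgz⟩
  have hfg : ∀ y ∈ t, ‖iteratedFDeriv ℝ n f y - iteratedFDeriv ℝ n g y‖ ≤ η / 4 := by
    intro y hy
    have h1 : dist (ev f) (ev g) ≤ η / 8 + η / 8 :=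
      (dist_triangle_right _ _ z).trans (add_le_add (Metric.mem_ball.1 hfz).le
        (Metric.mem_ball.1 hgz).le)
    have h2 := (dist_le_pi_dist (ev f) (ev g) ⟨y, hy⟩).trans h1
    rw [dist_eq_norm] at h2
    exact h2.trans (by linarith)
  refine lt_of_le_of_lt ?_ (half_lt_self hε)
  refine seminorm_le_bound ℝ k n _ (half_pos hε).le fun x => ?_
  rw [iteratedFDeriv_sub_apply]
  rcases le_or_gt ‖x‖ R with hx | hx
  · obtain ⟨y, hy, hxy⟩ := Set.mem_iUnion₂.1 (ht (mem_closedBall_zero_iff.2 hx))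
    rw [Metric.mem_ball, dist_eq_norm] at hxy
    have hlip : ∀ h ∈ B, ‖iteratedFDeriv ℝ n h x - iteratedFDeriv ℝ n h y‖ ≤ η / 8 := by
      intro h hh
      refine (norm_iteratedFDeriv_sub_le h n x y).trans (le_trans ?_ hCδ)
      exact mul_le_mul (hC₂ h hh) hxy.le (norm_nonneg _)
        ((apply_nonneg _ _).trans (hC₂ h hh))
    have hd : ‖iteratedFDeriv ℝ n f x - iteratedFDeriv ℝ n g x‖ ≤ η := by
      have e : iteratedFDeriv ℝ n f x - iteratedFDeriv ℝ n g x =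
          (iteratedFDeriv ℝ n f x - iteratedFDeriv ℝ n f y) +
          (iteratedFDeriv ℝ n f y - iteratedFDeriv ℝ n g y) -
          (iteratedFDeriv ℝ n g x - iteratedFDeriv ℝ n g y) := by abel
      rw [e]
      have h1 := norm_sub_le ((iteratedFDeriv ℝ n f x - iteratedFDeriv ℝ n f y) +
          (iteratedFDeriv ℝ n f y - iteratedFDeriv ℝ n g y))
          (iteratedFDeriv ℝ n g x - iteratedFDeriv ℝ n g y)
      have h2 := norm_add_le (iteratedFDeriv ℝ n f x - iteratedFDeriv ℝ n f y)
          (iteratedFDeriv ℝ n f y - iteratedFDeriv ℝ n g y)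
      linarith [hlip f hf, hlip g hg, hfg y hy]
    calc _ ≤ R ^ k * η := by gcongr
      _ = ε / 2 := hRη
  · have h1 := norm_pow_mul_iteratedFDeriv_sub_le f g (k + 1) n x
    have h2 := map_sub_le_add (SchwartzMap.seminorm ℝ (k + 1) n) f g
    have h3 : ‖x‖ ^ (k + 1) * ‖iteratedFDeriv ℝ n f x - iteratedFDeriv ℝ n g x‖ ≤ 2 * C₁ := by
      linarith [hC₁ f hf, hC₁ g hg]
    rw [pow_succ', mul_assoc] at h3
    set d := ‖x‖ ^ k * ‖iteratedFDeriv ℝ n f x - iteratedFDeriv ℝ n g x‖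
    have hd : 0 ≤ d := by positivity
    have h4 : R * d ≤ R * (ε / 2) := by
      nlinarith
    exact le_of_mul_le_mul_left h4 hR0

theorem totallyBounded_of_isVonNBounded {𝕜 : Type*} [NontriviallyNormedField 𝕜]
    [NormedSpace 𝕜 F] [SMulCommClass ℝ 𝕜 F] [FiniteDimensional ℝ E] [FiniteDimensional ℝ F]
    {B : Set 𝓢(E, F)} (hB : Bornology.IsVonNBounded 𝕜 B) : TotallyBounded B := by
  refine totallyBounded_of_seminorm_le fun k n => ?_
  obtain ⟨r, -, hr⟩ := (schwartz_withSeminorms 𝕜 E F).isVonNBounded_iff_seminorm_bounded.1 hB (k, n)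
  exact ⟨r, fun f hf => (hr f hf).le⟩

end SchwartzMap

/-! ### Functions with support in a fixed compact set -/

namespace ContDiffMapSupportedIn

variable {E F : Type*} [NormedAddCommGroup E] [NormedSpace ℝ E] [NormedAddCommGroup F]
  [NormedSpace ℝ F] {K : TopologicalSpace.Compacts E}

/-- Smooth functions supported in a compact set, as Schwartz functions. -/
noncomputable def toSchwartzLM : 𝓓_{K}(E, F) →ₗ[ℝ] 𝓢(E, F) where
  toFun f := f.hasCompactSupport.toSchwartzMap f.contDiff
  map_add' _ _ := rfl
  map_smul' _ _ := rfl

@[simp]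
theorem coe_toSchwartzLM (f : 𝓓_{K}(E, F)) : (toSchwartzLM f : E → F) = f := rfl

/-- On `K` the weight `‖x‖ ^ k` is at most `R ^ k`, so the weighted and unweighted seminorms are
equivalent. -/
theorem isInducing_toSchwartzLM :
    IsInducing (toSchwartzLM : 𝓓_{K}(E, F) →ₗ[ℝ] 𝓢(E, F)) := by
  obtain ⟨R, hR0, hR⟩ := K.isCompact.isBounded.exists_pos_norm_le
  have h : WithSeminorms ((schwartzSeminormFamily ℝ E F).comp
      (toSchwartzLM : 𝓓_{K}(E, F) →ₗ[ℝ] 𝓢(E, F))) := by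
    refine (ContDiffMapSupportedIn.withSeminorms ℝ E F ⊤ K).congr
      (.of_real fun ⟨k, i⟩ => ⟨{i}, R ^ k, fun f => ?_⟩) (.of_real fun i => ⟨{(0, i)}, 1, fun f => ?_⟩)
    · rw [Finset.sup_singleton]
      refine SchwartzMap.seminorm_le_bound ℝ k i _ (by positivity) fun x => ?_
      rw [coe_toSchwartzLM]
      by_cases hx : x ∈ K
      · have := norm_iteratedFDeriv_apply_le_seminorm_top ℝ (i := i) (f := f) (x := x)
        have := hR x hx
        gcongr
        assumption
      · change ‖x‖ ^ k * ‖iteratedFDeriv ℝ i f x‖ ≤ _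
        rw [f.iteratedFDeriv_zero_on_compl hx]
        simp only [Pi.zero_apply, norm_zero, mul_zero]
        positivity
    · rw [Finset.sup_singleton, one_mul]
      refine (ContDiffMapSupportedIn.seminorm_top_le_iff ℝ (apply_nonneg _ _) i f).2 fun x _ => ?_
      exact SchwartzMap.norm_iteratedFDeriv_le_seminorm ℝ (toSchwartzLM f) i x
  have h' := LinearMap.withSeminorms_induced (schwartz_withSeminorms ℝ E F)
    (toSchwartzLM : 𝓓_{K}(E, F) →ₗ[ℝ] 𝓢(E, F))
  exact ⟨h.withSeminorms_eq.trans
    (WithSeminorms.withSeminorms_eq (t := .induced toSchwartzLM inferInstance) h').symm⟩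

theorem isUniformInducing_toSchwartzLM :
    IsUniformInducing (toSchwartzLM : 𝓓_{K}(E, F) →ₗ[ℝ] 𝓢(E, F)) :=
  AddMonoidHom.isUniformInducing_of_isInducing isInducing_toSchwartzLM

/-- The range consists of the functions vanishing off `K`, cut out by continuous point evaluations.
-/
theorem isClosed_range_toSchwartzLM :
    IsClosed (Set.range (toSchwartzLM : 𝓓_{K}(E, F) →ₗ[ℝ] 𝓢(E, F))) := by
  have : Set.range (toSchwartzLM : 𝓓_{K}(E, F) →ₗ[ℝ] 𝓢(E, F)) =
      ⋂ x ∈ (K : Set E)ᶜ, {φ | φ x = 0} := by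
    ext φ
    simp only [Set.mem_range, Set.mem_iInter, Set.mem_ofPred_eq]
    constructor
    · rintro ⟨f, rfl⟩ x hx
      exact f.zero_on_compl hx
    · exact fun h => ⟨⟨φ, φ.smooth ⊤, fun x hx => h x hx⟩, rfl⟩
  rw [this]
  refine isClosed_biInter fun x _ => isClosed_eq ?_ continuous_const
  exact (continuous_eval_const x : Continuous fun g : BoundedContinuousFunction E F => g x).comp
    (SchwartzMap.toBoundedContinuousFunctionCLM ℝ E F).continuous

instance instCompleteSpace [CompleteSpace F] : CompleteSpace 𝓓_{K}(E, F) :=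
  (completeSpace_iff_isComplete_range isUniformInducing_toSchwartzLM).2
    isClosed_range_toSchwartzLM.isComplete

instance instFirstCountableTopology : FirstCountableTopology 𝓓_{K}(E, F) :=
  (ContDiffMapSupportedIn.withSeminorms ℝ E F ⊤ K).firstCountableTopology

instance instBaireSpace [CompleteSpace F] : BaireSpace 𝓓_{K}(E, F) := by
  have := IsUniformAddGroup.uniformity_countably_generated (α := 𝓓_{K}(E, F))
  infer_instance

theorem totallyBounded_of_isVonNBounded [FiniteDimensional ℝ E] [FiniteDimensional ℝ F]
    {B : Set 𝓓_{K}(E, F)} (hB : Bornology.IsVonNBounded ℝ B) : TotallyBounded B := by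
  rw [← totallyBounded_image_iff isUniformInducing_toSchwartzLM]
  exact SchwartzMap.totallyBounded_of_isVonNBounded
    (hB.image (⟨toSchwartzLM, isInducing_toSchwartzLM.continuous⟩ : 𝓓_{K}(E, F) →L[ℝ] 𝓢(E, F)))

end ContDiffMapSupportedIn

/-! ### The inductive limit `𝒟` -/

namespace TestFunction

variable {E F : Type*} [NormedAddCommGroup E] [NormedSpace ℝ E] [NormedAddCommGroup F]
  [NormedSpace ℝ F] {Ω : TopologicalSpace.Opens E}

/-- A seminorm on the space of test functions is continuous as soon as its restrictions to the
spaces of test functions supported in a fixed compact set are. -/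
theorem continuous_seminorm_of_comp (p : Seminorm ℝ 𝓓(Ω, F))
    (hp : ∀ (K : TopologicalSpace.Compacts E) (hK : (K : Set E) ⊆ Ω),
      Continuous (p ∘ ofSupportedIn hK : 𝓓_{K}(E, F) → ℝ)) : Continuous p := by
  let q : SeminormFamily ℝ 𝓓(Ω, F) Unit := fun _ => p
  -- The topology defined by `p` alone is locally convex, and by hypothesis all inclusions are
  -- continuous for it, so the inductive limit topology is finer.
  let t : TopologicalSpace 𝓓(Ω, F) := q.moduleFilterBasis.topology
  have hq : WithSeminorms (topology := t) q := @WithSeminorms.mk _ _ _ _ _ _ q t rfl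
  have h1 : @IsTopologicalAddGroup _ t _ := hq.topologicalAddGroup
  have h2 : @ContinuousSMul ℝ _ _ _ t := hq.continuousSMul
  have h3 : @LocallyConvexSpace ℝ _ _ _ _ _ t := hq.toLocallyConvexSpace
  have hle : topologicalSpace Ω F ⊤ ≤ t := by
    rw [topologicalSpace_le_iff]
    refine iSup₂_le fun K hK => continuous_iff_coinduced_le.1 ?_
    let L : 𝓓_{K}(E, F) →ₗ[ℝ] 𝓓(Ω, F) :=
      { toFun := ofSupportedIn hK
        map_add' := fun _ _ => rfl
        map_smul' := fun _ _ => rfl }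
    exact WithSeminorms.continuous_of_continuous_comp hq L fun _ => hp K hK
  exact continuous_le_dom hle (hq.continuous_seminorm ())

/-- A lower semicontinuous seminorm restricts to one on each `𝓓_{K}(E, F)`, which is Baire and hence
barrelled. -/
instance instBarrelledSpace [CompleteSpace F] : BarrelledSpace ℝ 𝓓(Ω, F) where
  continuous_of_lowerSemicontinuous p hp := continuous_seminorm_of_comp p fun K hK =>
    (p.comp (ofSupportedInCLM ℝ hK : 𝓓_{K}(E, F) →L[ℝ] 𝓓(Ω, F)).toLinearMap).continuous_of_lowerSemicontinuous
      (hp.comp (continuous_ofSupportedIn hK))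

/-- The functions in a bounded set of test functions are supported in a common ball. -/
theorem exists_forall_eq_zero_of_isVonNBounded [CompleteSpace F] {B : Set 𝓓(Ω, F)}
    (hB : Bornology.IsVonNBounded ℝ B) : ∃ R : ℝ, ∀ φ ∈ B, ∀ x, R < ‖x‖ → φ x = 0 := by
  by_contra! h
  choose φ hφB x hx hφx using fun k : ℕ => h k
  -- Normalised so that `p k (φ k) = k`. Since the points `x k` escape to infinity, only finitely
  -- many `p k` are nonzero at a given test function.
  let L : ℕ → 𝓓(Ω, F) →ₗ[ℝ] F := fun k =>
    { toFun := fun ψ => (k / ‖φ k (x k)‖) • ψ (x k)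
      map_add' := fun _ _ => smul_add _ _ _
      map_smul' := fun c ψ => smul_comm _ c (ψ (x k)) }
  let p : ℕ → Seminorm ℝ 𝓓(Ω, F) := fun k => (normSeminorm ℝ F).comp (L k)
  have hpcont : ∀ k, Continuous (p k) := fun k =>
    (((continuous_eval_const (x k) : Continuous fun ψ : 𝓓(Ω, F) => ψ (x k))).const_smul _).norm
  have hbdd : BddAbove (Set.range p) := by
    refine Seminorm.bddAbove_range_iff.2 fun ψ => ?_
    obtain ⟨R, hR⟩ := ψ.hasCompactSupport.isCompact.isBounded.exists_norm_le
    have : ∀ᶠ k : ℕ in atTop, p k ψ = 0 := by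
      filter_upwards [eventually_gt_atTop ⌈R⌉₊] with k hk
      have hψ : ψ (x k) = 0 := by
        refine image_eq_zero_of_notMem_tsupport fun hmem => ?_
        exact absurd (hR _ hmem) (not_le.2 (((Nat.le_ceil R).trans_lt (Nat.cast_lt.2 hk)).trans (hx k)))
      change ‖(k / ‖φ k (x k)‖) • ψ (x k)‖ = 0
      rw [hψ, smul_zero, norm_zero]
    exact (tendsto_const_nhds.congr' (this.mono fun _ h => h.symm)).bddAbove_range
  -- Barrelledness makes the pointwise finite supremum continuous, hence bounded on `B`, against `p
  -- k (φ k) = k`.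
  have hcont : Continuous (⨆ k, p k : Seminorm ℝ 𝓓(Ω, F)) := by
    rw [Seminorm.coe_iSup_eq hbdd]
    exact Seminorm.continuous_iSup p hpcont hbdd
  have hV : (⨆ k, p k : Seminorm ℝ 𝓓(Ω, F)).ball 0 1 ∈ 𝓝 (0 : 𝓓(Ω, F)) :=
    Seminorm.ball_mem_nhds hcont one_pos
  obtain ⟨r, hr⟩ := absorbs_iff_norm.1 (hB hV)
  obtain ⟨k, hk⟩ := exists_nat_gt (max r 1)
  have hk0 : (0 : ℝ) < k := one_pos.trans ((le_max_right _ _).trans_lt hk)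
  obtain ⟨ψ, hψ, hψk⟩ := hr k (by
    rw [Real.norm_of_nonneg hk0.le]; exact (le_max_left _ _).trans hk.le) (hφB k)
  have h1 : p k (φ k) ≤ (⨆ k, p k : Seminorm ℝ 𝓓(Ω, F)) (φ k) := by
    rw [Seminorm.iSup_apply hbdd]
    exact le_ciSup (Seminorm.bddAbove_range_iff.1 hbdd (φ k)) k
  have h2 : p k (φ k) = k := by
    change ‖(k / ‖φ k (x k)‖) • φ k (x k)‖ = k
    rw [norm_smul, norm_div, norm_norm, div_mul_cancel₀ _ (norm_ne_zero_iff.2 (hφx k)),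
      Real.norm_of_nonneg hk0.le]
  rw [Seminorm.mem_ball_zero] at hψ
  have hψk' : φ k = (k : ℝ) • ψ := hψk.symm
  rw [h2, hψk', map_smul_eq_mul, Real.norm_of_nonneg hk0.le] at h1
  nlinarith

/-- Test functions as Schwartz functions. -/
noncomputable def toSchwartzCLM : 𝓓(Ω, F) →L[ℝ] 𝓢(E, F) :=
  TestFunction.mkCLM ℝ (fun f => f.hasCompactSupport.toSchwartzMap f.contDiff)
    (fun _ _ => rfl) (fun _ _ => rfl)
    (fun _ _ => ContDiffMapSupportedIn.isInducing_toSchwartzLM.continuous)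

/-- With a common support `K`, `B` is the image of a subset of `𝓓_{K}(E, F)`. That subset is totally
bounded because its topology is induced from the Schwartz space, where the image of `B` is bounded.
-/
theorem totallyBounded_of_isVonNBounded [FiniteDimensional ℝ E] [FiniteDimensional ℝ F]
    {B : Set 𝓓((⊤ : TopologicalSpace.Opens E), F)} (hB : Bornology.IsVonNBounded ℝ B) :
    TotallyBounded B := by
  have : ProperSpace E := FiniteDimensional.proper_real E
  have : CompleteSpace F := FiniteDimensional.complete ℝ F
  obtain ⟨R, hR⟩ := exists_forall_eq_zero_of_isVonNBounded hB
  let K : TopologicalSpace.Compacts E := ⟨Metric.closedBall 0 R, isCompact_closedBall 0 R⟩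
  have hK : (K : Set E) ⊆ (⊤ : TopologicalSpace.Opens E) := fun _ _ => trivial
  let ι : 𝓓_{K}(E, F) →L[ℝ] 𝓓((⊤ : TopologicalSpace.Opens E), F) := ofSupportedInCLM ℝ hK
  have hBι : ι '' (ι ⁻¹' B) = B := by
    refine Set.image_preimage_eq_of_subset fun φ hφ => ?_
    refine ⟨⟨φ, φ.contDiff, fun x hx => hR φ hφ x ?_⟩, rfl⟩
    simpa [K] using hx
  rw [← hBι]
  refine TotallyBounded.image ?_ ι.uniformContinuous
  rw [← totallyBounded_image_iff ContDiffMapSupportedIn.isUniformInducing_toSchwartzLM]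
  refine (SchwartzMap.totallyBounded_of_isVonNBounded (hB.image toSchwartzCLM)).subset ?_
  rintro _ ⟨ψ, hψ, rfl⟩
  exact ⟨ι ψ, hψ, rfl⟩

end TestFunction

/-! ### The three test function spaces -/

theorem theorem1p4 (n : ℕ) {Y : Type*} [AddCommGroup Y] [Module ℂ Y]
    [UniformSpace Y] [IsUniformAddGroup Y] [ContinuousSMul ℂ Y] [LocallyConvexSpace ℝ Y]
    [T2Space Y] :
    (∀ a : ℝ, 0 < a →
      ∀ U ∈ 𝓝 (0 : TestD_a n a), ∀ (F : ℕ → TestD_a n a → Y) (f : TestD_a n a → Y),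
        (∀ ν, Continuous (F ν) ∧ F ν ∈ demiLinearK gammaZero U) →
        (∀ ξ, Tendsto (fun ν => F ν ξ) atTop (𝓝 (f ξ))) →
        (Continuous f ∧ f ∈ demiLinearK gammaZero U) ∧
          ∀ B : Set (TestD_a n a), Bornology.IsVonNBounded ℂ B → TendstoUniformlyOn F f atTop B) ∧
      (∀ U ∈ 𝓝 (0 : TestD n), ∀ (F : ℕ → TestD n → Y) (f : TestD n → Y),
        (∀ ν, Continuous (F ν) ∧ F ν ∈ demiLinearK gammaZero U) →
        (∀ ξ, Tendsto (fun ν => F ν ξ) atTop (𝓝 (f ξ))) →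
        (Continuous f ∧ f ∈ demiLinearK gammaZero U) ∧
          ∀ B : Set (TestD n), Bornology.IsVonNBounded ℂ B → TendstoUniformlyOn F f atTop B) ∧
      (∀ U ∈ 𝓝 (0 : TestS n), ∀ (F : ℕ → TestS n → Y) (f : TestS n → Y),
        (∀ ν, Continuous (F ν) ∧ F ν ∈ demiLinearK gammaZero U) →
        (∀ ξ, Tendsto (fun ν => F ν ξ) atTop (𝓝 (f ξ))) →
        (Continuous f ∧ f ∈ demiLinearK gammaZero U) ∧
          ∀ B : Set (TestS n), Bornology.IsVonNBounded ℂ B → TendstoUniformlyOn F f atTop B) := by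
  refine ⟨fun a _ U hU F f hF hlim => ?_, fun U hU F f hF hlim => ?_, fun U hU F f hF hlim => ?_⟩
  · have : IsScalarTower ℝ ℂ (TestD_a n a) := ⟨fun r z φ => by ext x; exact smul_assoc r z (φ x)⟩
    have htb : ∀ B : Set (TestD_a n a), Bornology.IsVonNBounded ℝ B → TotallyBounded B :=
      fun B hB => ContDiffMapSupportedIn.totallyBounded_of_isVonNBounded hB
    exact demiLinearK_limit (E := TestD_a n a) htb hU hF hlim
  · have : IsScalarTower ℝ ℂ (TestD n) := ⟨fun r z φ => by ext x; exact smul_assoc r z (φ x)⟩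
    have htb : ∀ B : Set (TestD n), Bornology.IsVonNBounded ℝ B → TotallyBounded B :=
      fun B hB => TestFunction.totallyBounded_of_isVonNBounded hB
    exact demiLinearK_limit (E := TestD n) htb hU hF hlim
  · have : IsScalarTower ℝ ℂ (TestS n) := ⟨fun r z φ => by ext x; exact smul_assoc r z (φ x)⟩
    have htb : ∀ B : Set (TestS n), Bornology.IsVonNBounded ℝ B → TotallyBounded B :=
      fun B hB => SchwartzMap.totallyBounded_of_isVonNBounded hB
    exact demiLinearK_limit (E := TestS n) htb hU hF hlim
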